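/- **Setting.** Let $d\ge 1$ be an integer, $\upsilon>0$ a path-loss exponent, and $\delta=d/\upsilon$. A transmitter sits at the origin of $\mathbb R^d$. Legitimate receivers ($i=b$) and eavesdroppers ($i=e$) are located at the points of two homogeneous Poisson point processes of densities $\lambda_b,\lambda_e>0$. Each receiver has a composite channel power gain $g$; the gains of the receivers of type $i$ are i.i.d., independent of the locations, with the $\alpha$-$\mu$ density $$f_{g_i}(x)=\frac{\alpha_i x^{\alpha_i\mu_i/2-1}}{2\,\Omega_i^{\alpha_i\mu_i/2}\,\Gamma(\mu_i)}\exp\!\Big(-\big(x/\Omega_i\big)^{\alpha_i/2}\Big),\qquad x>0,$$ with parameters $\alpha_i,\mu_i,\Omega_i>0$. The two marked processes (locations and gains) are independent of each other. Let $\eta_b,\eta_e>0$ be the transmit power-to-noise ratios of the legitimate receivers and of the eavesdroppers, and $\varpi=\eta_b/\eta_e$. For a receiver at distance $r$ with gain $g$ put $\xi=r^{\upsilon}/g$, so that its signal-to-noise ratio is $\eta_i/\xi$. Let $\xi_k$ be the $k$-th smallest value of $\xi$ among the legitimate receivers (the $k$-th best receiver, $k\ge1$), let $\xi_e$ be the smallest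 value of $\xi$ among the eavesdroppers (the best eavesdropper), and let $$\mathcal P_{nz,BB}(k)=\Pr\Big(\frac{\eta_b}{\xi_k}>\frac{\eta_e}{\xi_e}\Big)$$ be the probability of non-zero secrecy capacity. With $c_d=\pi^{d/2}/\Gamma(1+d/2)$, put $$A_{i0}=\frac{\lambda_i c_d\,\delta\,\Omega_i^{\delta}\,\Gamma(\mu_i+2\delta/\alpha_i)}{\Gamma(\mu_i)},\qquad A_{i1}=\frac{A_{i0}}{\delta}\quad(i\in\{b,e\}),\qquad \beta=\frac{A_{b1}}{A_{b1}+A_{e1}\varpi^{-\delta}} .$$ **Lemma (maximum number of best-ordered receivers).** (i) *Outage form.* Let $0\le\tau<1$ be a secrecy outage constraint and $k^*=\log_{\beta}(1-\tau)$. For every integer $k\ge1$: $1-\mathcal P_{nz,BB}(k)=\tau$ if and only if $k=k^*$, and $1-\mathcal P_{nz,BB}(k)\le\tau$ if and only if $k\le k^*$. Consequently the largest integer $K\ge 0$ such that each of the $K$ best legitimate receivers satisfies $1-\mathcal P_{nz,BB}(k)\le\tau$ is $\lfloor k^*\rfloor$. (ii) *Equivalent form in terms of the required probability of non-zero secrecy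 capacity.* Let $0<\tau\le1$ and $k^*=\log_{\beta}(\tau)$. For every integer $k\ge1$: $\mathcal P_{nz,BB}(k)=\tau$ if and only if $k=k^*$, and $\mathcal P_{nz,BB}(k)\ge\tau$ if and only if $k\le k^*$. Consequently the largest integer $K\ge 0$ such that each of the $K$ best legitimate receivers satisfies $\mathcal P_{nz,BB}(k)\ge\tau$ is $\lfloor k^*\rfloor$. -/

import Mathlib

open MeasureTheory ProbabilityTheory
open scoped ENNReal NNReal

noncomputable section

namespace SecrecyNet

/-- Number (with multiplicity) of points of the random sequence `X` that lie in `B`. -/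
def pointCount {S E : Type*} (X : ℕ → S → E) (B : Set E) (ω : S) : ℕ∞ :=
  {i : ℕ | X i ω ∈ B}.encard

/-- `X 0, X 1, …` is a measurable enumeration of the points of a Poisson point process with
intensity measure `m`: numbers of points in sets of finite intensity are Poisson distributed,
and numbers of points in pairwise disjoint sets are independent. -/
structure IsPoissonProcess {S E : Type*} [MeasurableSpace S] [MeasurableSpace E]
    (P : Measure S) (m : Measure E) (X : ℕ → S → E) : Prop where
  measurable : ∀ i, Measurable (X i)
  law_count : ∀ B : Set E, MeasurableSet B → m B ≠ ∞ →
    HasLaw (pointCount X B) ((poissonMeasure (m B).toNNReal).map (Nat.cast : ℕ → ℕ∞)) P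
  indep_count : ∀ (n : ℕ) (B : Fin n → Set E), (∀ j, MeasurableSet (B j)) →
    (∀ j, m (B j) ≠ ∞) → Pairwise (fun i j => Disjoint (B i) (B j)) →
    iIndepFun (fun j => pointCount X (B j)) P

/-- Density of the composite channel power gain under `α`-`μ` fading with scale `Ω`. -/
def alphaMuPDF (α μ Ω x : ℝ) : ℝ :=
  if 0 < x then
    α * x ^ (α * μ / 2 - 1) / (2 * Ω ^ (α * μ / 2) * Real.Gamma μ)
      * Real.exp (-(x / Ω) ^ (α / 2))
  else 0

/-- Law of the composite channel power gain under `α`-`μ` fading with scale `Ω`. -/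
def alphaMuLaw (α μ Ω : ℝ) : Measure ℝ :=
  volume.withDensity (fun x => ENNReal.ofReal (alphaMuPDF α μ Ω x))

/-- A population of receivers in `ℝ^d`: locations `X i` form a homogeneous Poisson point process
of density `lam`, and the gains `g i` are i.i.d. `α`-`μ` (scale `Ω`), independent of the
locations. -/
structure IsFadingPopulation {S : Type*} [MeasurableSpace S] (P : Measure S) (d : ℕ)
    (lam α μ Ω : ℝ) (X : ℕ → S → EuclideanSpace ℝ (Fin d)) (g : ℕ → S → ℝ) : Prop where
  locations : IsPoissonProcess P
    (ENNReal.ofReal lam • (volume : Measure (EuclideanSpace ℝ (Fin d)))) X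
  measurable_gain : ∀ i, Measurable (g i)
  law_gain : ∀ i, HasLaw (g i) (alphaMuLaw α μ Ω) P
  indep_gain : iIndepFun g P
  indep_locations_gain : IndepFun (fun ω i => X i ω) (fun ω i => g i ω) P

/-- The path-loss process with fading, `ξ_i = r_i ^ υ / g_i`, with the transmitter at the origin. -/
def fadedPathLoss {S : Type*} {d : ℕ} (υ : ℝ) (X : ℕ → S → EuclideanSpace ℝ (Fin d))
    (g : ℕ → S → ℝ) (ω : S) (i : ℕ) : ℝ :=
  ‖X i ω‖ ^ υ / g i ω

/-- The `k`-th smallest term (`k ≥ 1`) of a sequence: the least `t` such that at least `k` terms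
are at most `t`. -/
def kthSmallest (ξ : ℕ → ℝ) (k : ℕ) : ℝ :=
  sInf {t : ℝ | (k : ℕ∞) ≤ {i : ℕ | ξ i ≤ t}.encard}

/-- Probability of non-zero secrecy capacity of the `k`-th best legitimate receiver in the presence
of the best eavesdropper: `Pr (ηb / ξ_k > ηe / ξ_e)`, where `ξ_k` is the `k`-th smallest faded path
loss of the legitimate receivers and `ξ_e` is the smallest one of the eavesdroppers. -/
def probNonzeroBB {S : Type*} [MeasurableSpace S] (P : Measure S) (ηb ηe : ℝ)
    (ξb ξe : S → ℕ → ℝ) (k : ℕ) : ℝ :=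
  P.real {ω | ηb / kthSmallest (ξb ω) k > ηe / kthSmallest (ξe ω) 1}

/-- Volume `c_d` of the unit ball of `ℝ^d`. -/
def unitBallVolume (d : ℕ) : ℝ :=
  Real.pi ^ ((d : ℝ) / 2) / Real.Gamma (1 + (d : ℝ) / 2)

/-- `A_0 = lam c_d δ Ω^δ Γ(μ + 2δ/α) / Γ(μ)` with `δ = d / υ`. -/
def A0 (d : ℕ) (υ lam α μ Ω : ℝ) : ℝ :=
  lam * unitBallVolume d * (d / υ) * Ω ^ (d / υ) * Real.Gamma (μ + 2 * (d / υ) / α)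
    / Real.Gamma μ

/-- `A_1 = A_0 / δ` with `δ = d / υ`. -/
def A1 (d : ℕ) (υ lam α μ Ω : ℝ) : ℝ :=
  A0 d υ lam α μ Ω / (d / υ)

end SecrecyNet

end

/-! The heart of the matter is that `Pnz k = b ^ k` with `0 < b < 1`; both forms of the lemma then
follow by taking logarithms to base `b`.

By the marking theorem, the number of receivers with faded path loss at most `t` is Poisson with
mean `A1 * t ^ δ`, where `δ = d / υ`: integrating the volume of a ball over the gain produces the
`δ`-th moment of the gain. The theorem is proved through the Laplace functional
(`lintegral_expNeg_tsum`, `lintegral_expNeg_tsum_marked`) and the uniqueness of Laplace transforms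
on `ℕ∞` (`measure_enat_ext`).

The `k`-th smallest loss exceeds `t` exactly when fewer than `k` losses are at most `t`. Hence `A *
ξ_k ^ δ` has the Erlang law of order `k`, and the best eavesdropper satisfies `P (ξ_e > t) = exp (-B
* t ^ δ)`, with `A`, `B` the two values of `A1`. Conditioning on `ξ_k` turns `P (ξ_k < ϖ * ξ_e)`
into the Laplace transform `(1 / (1 + c)) ^ k` of the Erlang law at `c = B * ϖ ^ (-δ) / A`
(`lintegral_exp_neg_erlang`, `probNonzeroBB_eq_pow`). -/

open Filter Topology

namespace SecrecyNet

/-! ### The exponential on `[0, ∞]` and the Poisson Laplace transform. -/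

/-- The function `x ↦ exp (-x)` on `[0, ∞]`, with `exp (-∞) = 0`. -/
noncomputable def expNeg (x : ℝ≥0∞) : ℝ≥0∞ := EReal.exp (-(x : EReal))

@[simp] lemma expNeg_zero : expNeg 0 = 1 := by simp [expNeg]

@[simp] lemma expNeg_top : expNeg ∞ = 0 := by simp [expNeg]

lemma expNeg_ofReal {x : ℝ} (hx : 0 ≤ x) :
    expNeg (ENNReal.ofReal x) = ENNReal.ofReal (Real.exp (-x)) := by
  rw [expNeg, EReal.coe_ennreal_ofReal, max_eq_left hx, ← EReal.coe_neg, EReal.exp_coe]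

lemma expNeg_add (x y : ℝ≥0∞) : expNeg (x + y) = expNeg x * expNeg y := by
  rw [expNeg, EReal.coe_ennreal_add, EReal.neg_add, sub_eq_add_neg, EReal.exp_add]
  · rfl
  · left; simp
  · right; simp

lemma expNeg_sum {ι : Type*} (s : Finset ι) (f : ι → ℝ≥0∞) :
    expNeg (∑ i ∈ s, f i) = ∏ i ∈ s, expNeg (f i) := by
  classical
  induction s using Finset.induction_on with
  | empty => simp
  | insert a s ha ih => rw [Finset.sum_insert ha, Finset.prod_insert ha, expNeg_add, ih]

lemma expNeg_antitone : Antitone expNeg := fun _ _ hxy =>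
  EReal.exp_monotone (EReal.neg_le_neg_iff.2 (EReal.coe_ennreal_le_coe_ennreal_iff.2 hxy))

lemma expNeg_le_one (x : ℝ≥0∞) : expNeg x ≤ 1 :=
  expNeg_zero ▸ expNeg_antitone (zero_le : 0 ≤ x)

lemma continuous_expNeg : Continuous expNeg :=
  ENNReal.continuous_exp.comp (continuous_neg.comp continuous_coe_ennreal_ereal)

lemma measurable_expNeg : Measurable expNeg := continuous_expNeg.measurable

lemma expNeg_mul_natCast (c : ℝ≥0∞) (n : ℕ) : expNeg (c * n) = expNeg c ^ n := by
  have := expNeg_sum (Finset.range n) (fun _ => c)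
  simpa [mul_comm] using this

/-- An inverse of `expNeg` on `[0, 1]`. -/
noncomputable def negLog (y : ℝ≥0∞) : ℝ≥0∞ := (-(ENNReal.log y)).toENNReal

lemma measurable_negLog : Measurable negLog :=
  (ENNReal.measurable_log.neg).ereal_toENNReal

lemma expNeg_negLog {y : ℝ≥0∞} (hy : y ≤ 1) : expNeg (negLog y) = y := by
  have h : ENNReal.log y ≤ 0 := by simpa using ENNReal.log_monotone hy
  rw [expNeg, negLog, EReal.coe_toENNReal, neg_neg, ENNReal.exp_log]
  simpa using h

/-- Laplace transform of the Poisson distribution. -/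
lemma lintegral_expNeg_poisson (r : ℝ≥0) (c : ℝ≥0∞) :
    ∫⁻ n, expNeg (c * (n : ℕ∞)) ∂((poissonMeasure r).map (Nat.cast : ℕ → ℕ∞))
      = expNeg ((1 - expNeg c) * r) := by
  obtain ⟨q, hq⟩ : ∃ q : ℝ≥0, expNeg c = q :=
    ⟨_, (ENNReal.coe_toNNReal (ne_top_of_le_ne_top ENNReal.one_ne_top (expNeg_le_one c))).symm⟩
  have hq1 : q ≤ 1 := by
    have := expNeg_le_one c
    rw [hq] at this
    exact_mod_cast this
  rw [lintegral_map (Measurable.of_discrete) (Measurable.of_discrete), poissonMeasure,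
    lintegral_sum_measure]
  have h1 : ∀ n : ℕ, ∫⁻ a, expNeg (c * ((a : ℕ∞) : ℝ≥0∞))
      ∂(ENNReal.ofReal (Real.exp (-r) * r ^ n / n.factorial) • Measure.dirac n)
      = ENNReal.ofReal (Real.exp (-r) * ((r * q : ℝ) ^ n / n.factorial)) := by
    intro n
    rw [lintegral_smul_measure, lintegral_dirac]
    simp only [ENat.toENNReal_coe, expNeg_mul_natCast, hq, smul_eq_mul]
    rw [show ((q : ℝ≥0∞) ^ n) = ENNReal.ofReal ((q : ℝ) ^ n) by
      rw [ENNReal.ofReal_pow (by positivity), ENNReal.ofReal_coe_nnreal],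
      ← ENNReal.ofReal_mul (by positivity)]
    congr 1
    rw [mul_pow]; ring
  have hs : HasSum (fun n : ℕ => Real.exp (-r) * ((r * q : ℝ) ^ n / n.factorial))
      (Real.exp (-r) * Real.exp (r * q)) := by
    rw [Real.exp_eq_exp_ℝ]
    exact (NormedSpace.expSeries_div_hasSum_exp (r * q : ℝ)).mul_left _
  rw [tsum_congr h1, ← ENNReal.ofReal_tsum_of_nonneg (fun n => by positivity) hs.summable,
    hs.tsum_eq, hq, ← Real.exp_add]
  have : (1 - (q : ℝ≥0∞)) * r = ENNReal.ofReal ((1 - q) * r) := by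
    rw [ENNReal.ofReal_mul (by simpa using hq1), ENNReal.ofReal_sub _ (by positivity)]
    simp
  rw [this, expNeg_ofReal (mul_nonneg (by simpa using hq1) (by positivity))]
  congr 2; ring

/-! ### Laplace functionals of Poisson processes, plain and marked. -/

section Counting

variable {S E : Type*} [MeasurableSpace E]

/-- A realisation is viewed as a counting measure, so that sums over its points inherit the
decomposition and convergence theorems of `lintegral`. -/
lemma tsum_eq_lintegral_map_count (x : ℕ → E) {φ : E → ℝ≥0∞} (hφ : Measurable φ) :
    ∑' i, φ (x i) = ∫⁻ y, φ y ∂(Measure.count.map x) := by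
  rw [lintegral_map hφ Measurable.of_discrete, lintegral_count]

lemma map_count_apply_eq_pointCount (X : ℕ → S → E) {B : Set E} (hB : MeasurableSet B) (ω : S) :
    (Measure.count.map (fun i => X i ω)) B = (pointCount X B ω : ℝ≥0∞) := by
  rw [Measure.map_apply Measurable.of_discrete hB, Measure.count_apply (.of_discrete), pointCount]
  rfl

variable [MeasurableSpace S] {P : Measure S} {m : Measure E} {X : ℕ → S → E}

lemma measurable_pointCount (hX : ∀ i, Measurable (X i)) {B : Set E} (hB : MeasurableSet B) :
    Measurable (pointCount X B) :=
  measurable_encard.comp (measurable_set_iff.2 fun i => measurableSet_setOfPred.1 (hX i hB))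

/-- Laplace functional of a Poisson process at a simple function. -/
lemma IsPoissonProcess.lintegral_expNeg_tsum_simpleFunc (hX : IsPoissonProcess P m X)
    (φ : SimpleFunc E ℝ≥0∞) (hφ : m (Function.support φ) ≠ ∞) :
    ∫⁻ ω, expNeg (∑' i, φ (X i ω)) ∂P = expNeg (∫⁻ x, (1 - expNeg (φ x)) ∂m) := by
  classical
  -- The zero level is left out: it may have infinite intensity, while every other level set lies in
  -- the support.
  set T := φ.range.filter (· ≠ 0) with hT
  let e := T.equivFin
  let B : Fin T.card → Set E := fun j => φ ⁻¹' {(e.symm j : ℝ≥0∞)}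
  have hBm : ∀ j, MeasurableSet (B j) := fun j => φ.measurableSet_fiber _
  have hBf : ∀ j, m (B j) ≠ ∞ := fun j => by
    refine ne_top_of_le_ne_top hφ (measure_mono fun x hx => ?_)
    have h0 := (Finset.mem_filter.1 (e.symm j).2).2
    have : φ x = e.symm j := hx
    simpa [this] using h0
  have hBd : Pairwise (fun i j => Disjoint (B i) (B j)) := by
    intro i j hij
    refine Set.disjoint_left.2 fun x hx hx' => hij ?_
    have h1 : φ x = e.symm i := hx
    have h2 : φ x = e.symm j := hx'
    exact e.symm.injective (Subtype.ext (h1.symm.trans h2))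
  -- Used twice: pathwise for the counting measure with `F = id`, and for `m` with `F c = 1 - expNeg
  -- c`.
  have hsum : ∀ F : ℝ≥0∞ → ℝ≥0∞, F 0 = 0 → ∀ μ : Measure E,
      ∫⁻ x, F (φ x) ∂μ = ∑ j, F (e.symm j) * μ (B j) := by
    intro F hF μ
    have h1 : ∫⁻ x, F (φ x) ∂μ = (φ.map F).lintegral μ := by
      rw [← SimpleFunc.lintegral_eq_lintegral]; rfl
    rw [h1, SimpleFunc.map_lintegral, ← Finset.sum_filter_of_ne (p := (· ≠ 0)),
      ← hT, ← Finset.sum_coe_sort, ← Equiv.sum_comp e.symm]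
    intro c _ hc h0
    rw [h0, hF, zero_mul] at hc
    exact hc rfl
  have hlhs : ∀ ω, expNeg (∑' i, φ (X i ω))
      = ∏ j, expNeg ((e.symm j : ℝ≥0∞) * (pointCount X (B j) ω : ℝ≥0∞)) := by
    intro ω
    rw [tsum_eq_lintegral_map_count (fun i => X i ω) φ.measurable,
      show ∫⁻ y, φ y ∂(Measure.count.map fun i => X i ω) = _ from hsum id rfl _, expNeg_sum]
    refine Finset.prod_congr rfl fun j _ => ?_
    rw [map_count_apply_eq_pointCount X (hBm j)]; rfl
  have hind := hX.indep_count _ B hBm hBf hBd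
  have hind' := hind.comp (fun j (n : ℕ∞) => expNeg ((e.symm j : ℝ≥0∞) * (n : ℝ≥0∞)))
    (fun _ => Measurable.of_discrete)
  rw [hsum (fun c => 1 - expNeg c) (by simp), expNeg_sum]
  simp_rw [hlhs]
  have hmeas : ∀ j, Measurable fun ω =>
      expNeg ((e.symm j : ℝ≥0∞) * (pointCount X (B j) ω : ℝ≥0∞)) := fun j =>
    (Measurable.of_discrete (f := fun n : ℕ∞ => expNeg ((e.symm j : ℝ≥0∞) * (n : ℝ≥0∞)))).comp
      (measurable_pointCount hX.measurable (hBm j))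
  refine (lintegral_prod_eq_prod_lintegral_of_indepFun Finset.univ _ hind' hmeas).trans ?_
  refine Finset.prod_congr rfl fun j _ => ?_
  have := (hX.law_count _ (hBm j) (hBf j)).lintegral_comp
    (f := fun n : ℕ∞ => expNeg ((e.symm j : ℝ≥0∞) * (n : ℝ≥0∞))) Measurable.of_discrete.aemeasurable
  rw [lintegral_expNeg_poisson, ENNReal.coe_toNNReal (hBf j)] at this
  exact this

/-- Laplace functional of a Poisson process. -/
lemma IsPoissonProcess.lintegral_expNeg_tsum [IsProbabilityMeasure P] [SigmaFinite m]
    (hX : IsPoissonProcess P m X) {φ : E → ℝ≥0∞} (hφ : Measurable φ) :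
    ∫⁻ ω, expNeg (∑' i, φ (X i ω)) ∂P = expNeg (∫⁻ x, (1 - expNeg (φ x)) ∂m) := by
  -- Restricting to the spanning sets gives each approximant a support of finite intensity.
  let ψ : ℕ → SimpleFunc E ℝ≥0∞ := fun n => (SimpleFunc.eapprox φ n).restrict (spanningSets m n)
  have hψ : ∀ n x, ψ n x = (spanningSets m n).indicator (SimpleFunc.eapprox φ n) x := fun n x => by
    rw [SimpleFunc.restrict_apply _ (measurableSet_spanningSets m n)]
  have hmono : ∀ x, Monotone fun n => ψ n x := by
    intro x n k hnk
    simp only [hψ]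
    exact (Set.indicator_le_indicator (SimpleFunc.monotone_eapprox φ hnk x)).trans
      (Set.indicator_le_indicator_of_subset (monotone_spanningSets m hnk) (fun _ => zero_le) x)
  have hlim : ∀ x, Tendsto (fun n => ψ n x) atTop (𝓝 (φ x)) := by
    intro x
    refine (SimpleFunc.tendsto_eapprox hφ x).congr' ?_
    filter_upwards [eventually_ge_atTop (spanningSetsIndex m x)] with n hn
    rw [hψ, Set.indicator_of_mem (mem_spanningSets_of_index_le m x hn)]
  have hfin : ∀ n, m (Function.support (ψ n)) ≠ ∞ := fun n => by
    refine ne_top_of_le_ne_top (measure_spanningSets_lt_top m n).ne (measure_mono fun x hx => ?_)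
    by_contra hxn
    exact hx (by rw [hψ, Set.indicator_of_notMem hxn])
  have h1 : Tendsto (fun n => ∫⁻ ω, expNeg (∑' i, ψ n (X i ω)) ∂P) atTop
      (𝓝 (∫⁻ ω, expNeg (∑' i, φ (X i ω)) ∂P)) := by
    refine tendsto_lintegral_of_dominated_convergence (fun _ => 1) (fun n => ?_)
      (fun n => .of_forall fun ω => expNeg_le_one _) (by simp) (.of_forall fun ω => ?_)
    · exact measurable_expNeg.comp (Measurable.tsum
        fun i => (ψ n).measurable.comp (hX.measurable i))
    · refine (continuous_expNeg.tendsto _).comp ?_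
      simp_rw [fun n => tsum_eq_lintegral_map_count (fun i => X i ω) (ψ n).measurable,
        tsum_eq_lintegral_map_count (fun i => X i ω) hφ]
      exact lintegral_tendsto_of_tendsto_of_monotone (fun n => (ψ n).measurable.aemeasurable)
        (.of_forall hmono) (.of_forall hlim)
  have h2 : Tendsto (fun n => expNeg (∫⁻ x, (1 - expNeg (ψ n x)) ∂m)) atTop
      (𝓝 (expNeg (∫⁻ x, (1 - expNeg (φ x)) ∂m))) := by
    refine (continuous_expNeg.tendsto _).comp ?_
    refine lintegral_tendsto_of_tendsto_of_monotone
      (fun n => (measurable_const.sub (measurable_expNeg.comp (ψ n).measurable)).aemeasurable)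
      (.of_forall fun x n k hnk => tsub_le_tsub_left (expNeg_antitone (hmono x hnk)) _)
      (.of_forall fun x => ?_)
    exact ENNReal.Tendsto.sub tendsto_const_nhds ((continuous_expNeg.tendsto _).comp (hlim x))
      (Or.inl ENNReal.one_ne_top)
  refine tendsto_nhds_unique h1 (h2.congr fun n => ?_)
  rw [hX.lintegral_expNeg_tsum_simpleFunc (ψ n) (hfin n)]

/-- Laplace functional of an independently marked Poisson process. -/
lemma IsPoissonProcess.lintegral_expNeg_tsum_marked [IsProbabilityMeasure P] [SigmaFinite m]
    (hX : IsPoissonProcess P m X) {M : Type*} [MeasurableSpace M] {g : ℕ → S → M}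
    {ν : Measure M} [IsProbabilityMeasure ν]
    (hgm : ∀ i, Measurable (g i)) (hgl : ∀ i, HasLaw (g i) ν P) (hgi : iIndepFun g P)
    (hXg : IndepFun (fun ω i => X i ω) (fun ω i => g i ω) P)
    {ψ : E × M → ℝ≥0∞} (hψ : Measurable ψ) :
    ∫⁻ ω, expNeg (∑' i, ψ (X i ω, g i ω)) ∂P
      = expNeg (∫⁻ x, (1 - ∫⁻ γ, expNeg (ψ (x, γ)) ∂ν) ∂m) := by
  have hψ' : Measurable fun z => expNeg (ψ z) := measurable_expNeg.comp hψ
  let H : E → ℝ≥0∞ := fun x => ∫⁻ γ, expNeg (ψ (x, γ)) ∂ν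
  have hHm : Measurable H := hψ'.lintegral_prod_right'
  have hH1 : ∀ x, H x ≤ 1 := fun x => by
    calc H x ≤ ∫⁻ _, 1 ∂ν := lintegral_mono fun _ => expNeg_le_one _
      _ = 1 := by simp
  -- Given the locations, the gains integrate out to `∏ H (X i)`, so marked points act like unmarked
  -- ones weighted by `negLog ∘ H`. Independence is applied to finite products; `key` then lets `n`
  -- tend to infinity.
  have hfinite : ∀ n, ∫⁻ ω, expNeg (∑ i ∈ Finset.range n, ψ (X i ω, g i ω)) ∂P
      = ∫⁻ ω, expNeg (∑ i ∈ Finset.range n, negLog (H (X i ω))) ∂P := by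
    intro n
    simp_rw [expNeg_sum, fun x => expNeg_negLog (hH1 x)]
    have hmX : Measurable (fun ω i => X i ω) := measurable_pi_lambda _ hX.measurable
    have hmg : Measurable (fun ω i => g i ω) := measurable_pi_lambda _ hgm
    have hF : Measurable fun z : (ℕ → E) × (ℕ → M) =>
        ∏ i ∈ Finset.range n, expNeg (ψ (z.1 i, z.2 i)) :=
      Finset.measurable_prod _ fun i _ => hψ'.comp (by fun_prop)
    have hlaw := (indepFun_iff_map_prod_eq_prod_map_map hmX.aemeasurable hmg.aemeasurable).1 hXg
    calc ∫⁻ ω, ∏ i ∈ Finset.range n, expNeg (ψ (X i ω, g i ω)) ∂P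
        = ∫⁻ z, ∏ i ∈ Finset.range n, expNeg (ψ (z.1 i, z.2 i))
            ∂(P.map (fun ω => ((fun i => X i ω), (fun i => g i ω)))) := by
          rw [lintegral_map hF (hmX.prodMk hmg)]
      _ = ∫⁻ x, ∫⁻ γ, ∏ i ∈ Finset.range n, expNeg (ψ (x i, γ i))
            ∂(P.map (fun ω i => g i ω)) ∂(P.map (fun ω i => X i ω)) := by
          rw [hlaw, lintegral_prod _ hF.aemeasurable]
      _ = ∫⁻ x, ∏ i ∈ Finset.range n, H (x i) ∂(P.map (fun ω i => X i ω)) := by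
          refine lintegral_congr fun x => ?_
          have hFx : Measurable fun γ : ℕ → M => ∏ i ∈ Finset.range n, expNeg (ψ (x i, γ i)) :=
            hF.comp measurable_prodMk_left
          rw [lintegral_map hFx hmg]
          have hi : iIndepFun (fun i ω => expNeg (ψ (x i, g i ω))) P :=
            hgi.comp (fun i γ => expNeg (ψ (x i, γ))) fun i => hψ'.comp measurable_prodMk_left
          rw [lintegral_prod_eq_prod_lintegral_of_indepFun _ _ hi
            fun i => hψ'.comp (measurable_const.prodMk (hgm i))]
          refine Finset.prod_congr rfl fun i _ => ?_
          exact (hgl i).lintegral_comp (hψ'.comp measurable_prodMk_left).aemeasurable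
      _ = ∫⁻ ω, ∏ i ∈ Finset.range n, H (X i ω) ∂P := by
          have hHp : Measurable fun x : ℕ → E => ∏ i ∈ Finset.range n, H (x i) :=
            Finset.measurable_prod _ fun i _ => hHm.comp (measurable_pi_apply i)
          rw [lintegral_map hHp hmX]
  have key : ∀ f : ℕ → S → ℝ≥0∞, (∀ i, Measurable (f i)) →
      Tendsto (fun n => ∫⁻ ω, expNeg (∑ i ∈ Finset.range n, f i ω) ∂P) atTop
        (𝓝 (∫⁻ ω, expNeg (∑' i, f i ω) ∂P)) := by
    intro f hf
    refine tendsto_lintegral_of_dominated_convergence (fun _ => 1)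
      (fun n => measurable_expNeg.comp (Finset.measurable_sum _ fun i _ => hf i))
      (fun n => .of_forall fun ω => expNeg_le_one _) (by simp) (.of_forall fun ω => ?_)
    exact (continuous_expNeg.tendsto _).comp ENNReal.summable.hasSum.tendsto_sum_nat
  have h1 := key (fun i ω => ψ (X i ω, g i ω)) fun i => hψ.comp ((hX.measurable i).prodMk (hgm i))
  have h2 := key (fun i ω => negLog (H (X i ω)))
    fun i => measurable_negLog.comp (hHm.comp (hX.measurable i))
  rw [tendsto_nhds_unique h1 (h2.congr fun n => (hfinite n).symm),
    hX.lintegral_expNeg_tsum (φ := fun x => negLog (H x)) (measurable_negLog.comp hHm)]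
  simp_rw [fun x => expNeg_negLog (hH1 x)]
  rfl

end Counting

/-! ### Uniqueness of Laplace transforms on `ℕ∞`. -/

/-- Power series with equal sums on `(0, 1)` have comparable constant coefficients. -/
lemma coeff_zero_le_of_tsum_eq {a b : ℕ → ℝ≥0∞} (hb : ∑' n, b n ≠ ∞)
    (h : ∀ s : ℝ≥0, 0 < s → s < 1 → ∑' n, a n * (s : ℝ≥0∞) ^ n = ∑' n, b n * (s : ℝ≥0∞) ^ n) :
    a 0 ≤ b 0 := by
  have hlim : Tendsto (fun s : ℝ≥0 => b 0 + (s : ℝ≥0∞) * ∑' n, b n) (𝓝[>] 0) (𝓝 (b 0)) := by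
    have h1 : Tendsto (fun s : ℝ≥0 => b 0 + (s : ℝ≥0∞) * ∑' n, b n) (𝓝 0)
        (𝓝 (b 0 + ((0 : ℝ≥0) : ℝ≥0∞) * ∑' n, b n)) :=
      tendsto_const_nhds.add (ENNReal.Tendsto.mul_const (ENNReal.tendsto_coe.2 tendsto_id)
        (Or.inr hb))
    simpa using h1.mono_left nhdsWithin_le_nhds
  refine ge_of_tendsto hlim ?_
  filter_upwards [Ioo_mem_nhdsGT (zero_lt_one : (0 : ℝ≥0) < 1)] with s hs
  calc a 0 ≤ ∑' n, a n * (s : ℝ≥0∞) ^ n := by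
        simpa using ENNReal.le_tsum (f := fun n => a n * (s : ℝ≥0∞) ^ n) 0
    _ = b 0 + ∑' n, b (n + 1) * (s : ℝ≥0∞) ^ (n + 1) := by
        rw [h s hs.1 hs.2, tsum_eq_zero_add' ENNReal.summable]; simp
    _ ≤ b 0 + (s : ℝ≥0∞) * ∑' n, b n := by
        gcongr
        rw [← ENNReal.tsum_mul_left]
        refine (ENNReal.tsum_le_tsum fun n => ?_).trans
          (ENNReal.tsum_comp_le_tsum_of_injective (add_left_injective 1)
            fun n => (s : ℝ≥0∞) * b n)
        rw [mul_comm, pow_succ, mul_comm _ (s : ℝ≥0∞), mul_assoc]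
        refine mul_le_mul_right ?_ _
        exact mul_le_of_le_one_left' (pow_le_one' (by exact_mod_cast hs.2.le) n)

/-- Power series with equal sums on `(0, 1)` have equal coefficients. -/
lemma coeff_eq_of_tsum_eq (n : ℕ) : ∀ {a b : ℕ → ℝ≥0∞}, ∑' n, a n ≠ ∞ → ∑' n, b n ≠ ∞ →
    (∀ s : ℝ≥0, 0 < s → s < 1 → ∑' n, a n * (s : ℝ≥0∞) ^ n = ∑' n, b n * (s : ℝ≥0∞) ^ n) →
    a n = b n := by
  induction n with
  | zero =>
    exact fun ha hb h => le_antisymm (coeff_zero_le_of_tsum_eq hb h)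
      (coeff_zero_le_of_tsum_eq ha fun s h0 h1 => (h s h0 h1).symm)
  | succ n ih =>
    intro a b ha hb h
    have h0 : a 0 = b 0 := le_antisymm (coeff_zero_le_of_tsum_eq hb h)
      (coeff_zero_le_of_tsum_eq ha fun s h0 h1 => (h s h0 h1).symm)
    have hle : ∀ f : ℕ → ℝ≥0∞, ∑' n, f (n + 1) ≤ ∑' n, f n := fun f =>
      ENNReal.tsum_comp_le_tsum_of_injective (add_left_injective 1) f
    refine ih (a := fun n => a (n + 1)) (b := fun n => b (n + 1))
      (ne_top_of_le_ne_top ha (hle a)) (ne_top_of_le_ne_top hb (hle b)) fun s hs0 hs1 => ?_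
    have hsplit : ∀ f : ℕ → ℝ≥0∞, ∑' n, f n * (s : ℝ≥0∞) ^ n
        = f 0 + (s : ℝ≥0∞) * ∑' n, f (n + 1) * (s : ℝ≥0∞) ^ n := fun f => by
      rw [tsum_eq_zero_add' ENNReal.summable, ← ENNReal.tsum_mul_left]
      simp only [pow_zero, mul_one]
      congr 2 with n
      ring
    have := h s hs0 hs1
    rw [hsplit a, hsplit b, h0, ENNReal.add_right_inj (ne_top_of_le_ne_top hb (ENNReal.le_tsum 0)),
      ENNReal.mul_right_inj (by exact_mod_cast hs0.ne') ENNReal.coe_ne_top] at this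
    exact this

/-- For `θ ≠ 0` the point `⊤` contributes `expNeg ∞ = 0`; at `θ = 0` it would count with weight one.
-/
lemma lintegral_expNeg_mul_enat (μ : Measure ℕ∞) {θ : ℝ≥0∞} (hθ : θ ≠ 0) :
    ∫⁻ n : ℕ∞, expNeg (θ * n) ∂μ = ∑' n : ℕ, μ {(n : ℕ∞)} * expNeg θ ^ n := by
  rw [lintegral_countable', ← Function.Injective.tsum_eq (g := (Nat.cast : ℕ → ℕ∞))
    Nat.cast_injective]
  · simp_rw [ENat.toENNReal_coe, expNeg_mul_natCast, mul_comm]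
  · intro n hn
    induction n using ENat.recTopCoe with
    | top => simp [ENNReal.mul_top hθ] at hn
    | coe n => exact ⟨n, rfl⟩

lemma tsum_measure_singleton_natCast (μ : Measure ℕ∞) :
    ∑' n : ℕ, μ {(n : ℕ∞)} = μ {⊤}ᶜ := by
  have : ({⊤}ᶜ : Set ℕ∞) = ⋃ n : ℕ, {(n : ℕ∞)} := by
    ext n
    induction n using ENat.recTopCoe with
    | top => simp
    | coe n => simp
  rw [this, measure_iUnion _ fun _ => .of_discrete]
  intro i j hij
  simpa using hij

/-- Finite measures on `ℕ∞` are determined by their Laplace transforms. -/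
lemma measure_enat_ext {μ ν : Measure ℕ∞} [IsFiniteMeasure μ] [IsFiniteMeasure ν]
    (h : ∀ θ : ℝ≥0∞, ∫⁻ n : ℕ∞, expNeg (θ * n) ∂μ = ∫⁻ n : ℕ∞, expNeg (θ * n) ∂ν) : μ = ν := by
  have hcoe : ∀ n : ℕ, μ {(n : ℕ∞)} = ν {(n : ℕ∞)} := fun n => by
    refine coeff_eq_of_tsum_eq n (a := fun n => μ {(n : ℕ∞)}) (b := fun n => ν {(n : ℕ∞)})
      ?_ ?_ fun s hs0 hs1 => ?_
    · rw [tsum_measure_singleton_natCast]; exact measure_ne_top _ _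
    · rw [tsum_measure_singleton_natCast]; exact measure_ne_top _ _
    · have hs : expNeg (negLog s) = s := expNeg_negLog (by exact_mod_cast hs1.le)
      have h0 : negLog s ≠ 0 := fun h0 => by
        rw [h0, expNeg_zero] at hs
        exact hs1.ne (by exact_mod_cast hs.symm)
      have := h (negLog s)
      rwa [lintegral_expNeg_mul_enat μ h0, lintegral_expNeg_mul_enat ν h0, hs] at this
  -- The mass at `⊤` is seen only by `θ = 0`, through the total mass.
  have huniv : μ Set.univ = ν Set.univ := by simpa using h 0
  refine Measure.ext_of_singleton fun n => ?_
  induction n using ENat.recTopCoe with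
  | coe n => exact hcoe n
  | top =>
    have hc : μ {⊤}ᶜ = ν {⊤}ᶜ := by
      rw [← tsum_measure_singleton_natCast, ← tsum_measure_singleton_natCast, tsum_congr hcoe]
    have hsub : ∀ ρ : Measure ℕ∞, IsFiniteMeasure ρ → ρ {⊤} = ρ Set.univ - ρ {⊤}ᶜ := fun ρ _ => by
      rw [← measure_compl .of_discrete (measure_ne_top _ _), compl_compl]
    rw [hsub μ inferInstance, hsub ν inferInstance, huniv, hc]

/-- Marking theorem, for the count of one set: in an independently marked Poisson process the
number of marked points in a set is Poisson distributed with the product intensity. -/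
lemma IsPoissonProcess.hasLaw_pointCount_marked {S E M : Type*} [MeasurableSpace S]
    [MeasurableSpace E] [MeasurableSpace M] {P : Measure S} [IsProbabilityMeasure P]
    {m : Measure E} [SigmaFinite m] {X : ℕ → S → E} (hX : IsPoissonProcess P m X)
    {g : ℕ → S → M} {ν : Measure M} [IsProbabilityMeasure ν]
    (hgm : ∀ i, Measurable (g i)) (hgl : ∀ i, HasLaw (g i) ν P) (hgi : iIndepFun g P)
    (hXg : IndepFun (fun ω i => X i ω) (fun ω i => g i ω) P)
    {D : Set (E × M)} (hD : MeasurableSet D) (hDf : (m.prod ν) D ≠ ∞) :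
    HasLaw (pointCount (fun i ω => (X i ω, g i ω)) D)
      ((poissonMeasure ((m.prod ν) D).toNNReal).map (Nat.cast : ℕ → ℕ∞)) P := by
  have hN := measurable_pointCount (fun i => (hX.measurable i).prodMk (hgm i)) hD
  refine ⟨hN.aemeasurable, ?_⟩
  have := Measure.isProbabilityMeasure_map hN.aemeasurable (μ := P)
  refine measure_enat_ext fun θ => ?_
  rw [lintegral_expNeg_poisson, lintegral_map .of_discrete hN, ENNReal.coe_toNNReal hDf]
  have hψ : Measurable (D.indicator fun _ => θ) := measurable_const.indicator hD
  -- The scaled count is the sum of an indicator over the marked points, so the marked Laplace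
  -- functional gives its Laplace transform.
  have h1 : ∀ ω, θ * (pointCount (fun i ω => (X i ω, g i ω)) D ω : ℝ≥0∞)
      = ∑' i, D.indicator (fun _ => θ) (X i ω, g i ω) := fun ω => by
    rw [tsum_eq_lintegral_map_count (fun i => (X i ω, g i ω)) hψ, lintegral_indicator_const hD,
      map_count_apply_eq_pointCount (fun i ω => (X i ω, g i ω)) hD]
  simp_rw [h1]
  rw [hX.lintegral_expNeg_tsum_marked hgm hgl hgi hXg hψ, Measure.prod_apply hD,
    ← lintegral_const_mul _ (measurable_measure_prodMk_left hD)]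
  congr 1
  refine lintegral_congr fun x => ?_
  have hm : Measurable fun γ => expNeg (D.indicator (fun _ => θ) (x, γ)) :=
    measurable_expNeg.comp (hψ.comp measurable_prodMk_left)
  have hfin : ∫⁻ γ, expNeg (D.indicator (fun _ => θ) (x, γ)) ∂ν ≠ ∞ := by
    refine ne_top_of_le_ne_top ENNReal.one_ne_top
      ((lintegral_mono fun γ => expNeg_le_one _).trans ?_)
    simp
  have h2 := lintegral_sub (μ := ν) hm hfin (.of_forall fun γ => expNeg_le_one _)
  simp only [lintegral_one, measure_univ] at h2
  rw [← h2, ← lintegral_indicator_const (measurable_prodMk_left hD)]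
  refine lintegral_congr fun γ => ?_
  by_cases hγ : (x, γ) ∈ D
  · rw [Set.indicator_of_mem hγ, Set.indicator_of_mem (by exact hγ)]
  · rw [Set.indicator_of_notMem hγ, Set.indicator_of_notMem (by exact hγ)]
    simp

/-! ### Fading moments and the intensity of faded path losses. -/

lemma measurable_alphaMuPDF (α μ Ω : ℝ) : Measurable (alphaMuPDF α μ Ω) := by
  unfold alphaMuPDF
  exact Measurable.ite measurableSet_Ioi (by fun_prop) measurable_const

lemma ae_pos_alphaMuLaw (α μ Ω : ℝ) : ∀ᵐ γ ∂(alphaMuLaw α μ Ω), 0 < γ := by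
  rw [alphaMuLaw, ae_withDensity_iff (measurable_alphaMuPDF α μ Ω).ennreal_ofReal]
  refine .of_forall fun γ hγ => ?_
  by_contra h
  simp [alphaMuPDF, h] at hγ

/-- Moments of the `α`-`μ` distribution. -/
lemma lintegral_rpow_alphaMuLaw {α μ Ω s : ℝ} (hα : 0 < α) (hμ : 0 < μ) (hΩ : 0 < Ω)
    (hs : 0 ≤ s) :
    ∫⁻ γ, ENNReal.ofReal (γ ^ s) ∂(alphaMuLaw α μ Ω)
      = ENNReal.ofReal (Ω ^ s * Real.Gamma (μ + 2 * s / α) / Real.Gamma μ) := by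
  have hΓ := Real.Gamma_pos_of_pos hμ
  set q : ℝ := α * μ / 2 - 1 + s with hq
  have hq1 : -1 < q := by have : 0 < α * μ / 2 := by positivity
                          linarith
  set b : ℝ := Ω ^ (-(α / 2)) with hb
  have hb0 : 0 < b := Real.rpow_pos_of_pos hΩ _
  set C : ℝ := α / (2 * Ω ^ (α * μ / 2) * Real.Gamma μ) with hC
  have hC0 : 0 ≤ C := by positivity
  have hint := (integrableOn_rpow_mul_exp_neg_mul_rpow hq1 (half_pos hα) hb0).const_mul C
  have hval := integral_rpow_mul_exp_neg_mul_rpow (half_pos hα) hq1 hb0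
  have hpt : ∀ γ : ℝ, (ENNReal.ofReal (alphaMuPDF α μ Ω γ)) * ENNReal.ofReal (γ ^ s)
      = (Set.Ioi (0 : ℝ)).indicator
        (fun x => ENNReal.ofReal (C * (x ^ q * Real.exp (-b * x ^ (α / 2))))) γ := by
    intro γ
    by_cases hγ : 0 < γ
    · rw [Set.indicator_of_mem (Set.mem_Ioi.2 hγ), alphaMuPDF, if_pos hγ, ← ENNReal.ofReal_mul (by positivity),
        hq, Real.rpow_add hγ, hb, hC, Real.rpow_neg hΩ.le, Real.div_rpow hγ.le hΩ.le]
      congr 1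
      rw [show -(γ ^ (α / 2) / Ω ^ (α / 2)) = -(Ω ^ (α / 2))⁻¹ * γ ^ (α / 2) by
        rw [div_eq_mul_inv]; ring]
      ring
    · rw [Set.indicator_of_notMem (by simpa using hγ), alphaMuPDF, if_neg hγ]; simp
  rw [alphaMuLaw, lintegral_withDensity_eq_lintegral_mul _
    (measurable_alphaMuPDF α μ Ω).ennreal_ofReal (by fun_prop)]
  simp only [Pi.mul_apply, hpt]
  rw [lintegral_indicator measurableSet_Ioi, ← ofReal_integral_eq_lintegral_ofReal hint,
    integral_const_mul, hval]
  · congr 1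
    have e1 : (q + 1) / (α / 2) = μ + 2 * s / α := by rw [hq]; field_simp; ring
    have e2 : b ^ (-(q + 1) / (α / 2)) = Ω ^ (α * μ / 2) * Ω ^ s := by
      rw [hb, ← Real.rpow_mul hΩ.le, ← Real.rpow_add hΩ]
      congr 1
      rw [hq]; field_simp; ring
    rw [e1, e2, hC]
    have := Real.rpow_pos_of_pos hΩ (α * μ / 2)
    field_simp
  · filter_upwards [ae_restrict_mem measurableSet_Ioi] with x hx
    have : 0 < x := hx
    simp only [Pi.zero_apply]
    positivity

lemma volume_setOf_norm_rpow_le (d : ℕ) (hd : 1 ≤ d) {υ r : ℝ} (hυ : 0 < υ) (hr : 0 ≤ r) :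
    volume {x : EuclideanSpace ℝ (Fin d) | ‖x‖ ^ υ ≤ r}
      = ENNReal.ofReal (unitBallVolume d * r ^ (d / υ)) := by
  have : Nonempty (Fin d) := ⟨⟨0, hd⟩⟩
  have hset : {x : EuclideanSpace ℝ (Fin d) | ‖x‖ ^ υ ≤ r} = Metric.closedBall 0 (r ^ υ⁻¹) := by
    ext x
    rw [mem_closedBall_zero_iff, Set.mem_ofPred_eq,
      Real.le_rpow_inv_iff_of_pos (norm_nonneg x) hr hυ]
  rw [hset, EuclideanSpace.volume_closedBall, Fintype.card_fin,
    ← ENNReal.ofReal_pow (by positivity), ← ENNReal.ofReal_mul (by positivity), unitBallVolume,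
    mul_comm]
  congr 2
  · rw [Real.sqrt_eq_rpow, ← Real.rpow_natCast, ← Real.rpow_mul Real.pi_pos.le, add_comm]
    congr 2; ring
  · rw [← Real.rpow_natCast, ← Real.rpow_mul hr]
    congr 1; field_simp

lemma unitBallVolume_pos (d : ℕ) : 0 < unitBallVolume d :=
  div_pos (Real.rpow_pos_of_pos Real.pi_pos _) (Real.Gamma_pos_of_pos (by positivity))

/-- The factor in parentheses is the `δ`-th moment of the gain, as computed in
`lintegral_rpow_alphaMuLaw`. -/
lemma A1_eq {d : ℕ} (hd : 1 ≤ d) {υ : ℝ} (hυ : 0 < υ) (lam α μ Ω : ℝ) :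
    A1 d υ lam α μ Ω = lam * unitBallVolume d *
      (Ω ^ (d / υ) * Real.Gamma (μ + 2 * (d / υ) / α) / Real.Gamma μ) := by
  have : (d / υ : ℝ) ≠ 0 := (div_pos (by exact_mod_cast hd) hυ).ne'
  rw [A1, A0]
  generalize (d / υ : ℝ) = δ at *
  field_simp

lemma A1_pos {d : ℕ} (hd : 1 ≤ d) {υ lam α μ Ω : ℝ} (hυ : 0 < υ) (hlam : 0 < lam) (hα : 0 < α)
    (hμ : 0 < μ) (hΩ : 0 < Ω) : 0 < A1 d υ lam α μ Ω := by
  have := unitBallVolume_pos d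
  have := Real.Gamma_pos_of_pos hμ
  have : 0 < Real.Gamma (μ + 2 * (d / υ) / α) := Real.Gamma_pos_of_pos (by positivity)
  rw [A1_eq hd hυ]
  positivity

lemma measurableSet_fadedPathLoss_le (d : ℕ) (υ t : ℝ) :
    MeasurableSet {z : EuclideanSpace ℝ (Fin d) × ℝ | ‖z.1‖ ^ υ / z.2 ≤ t} :=
  measurableSet_le (by fun_prop) measurable_const

/-- Intensity of the faded path loss process. -/
lemma intensity_fadedPathLoss_le {d : ℕ} (hd : 1 ≤ d) {υ lam α μ Ω : ℝ} (hυ : 0 < υ)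
    (hlam : 0 < lam) (hα : 0 < α) (hμ : 0 < μ) (hΩ : 0 < Ω) {t : ℝ} (ht : 0 ≤ t)
    [SFinite (alphaMuLaw α μ Ω)] :
    ((ENNReal.ofReal lam • (volume : Measure (EuclideanSpace ℝ (Fin d)))).prod (alphaMuLaw α μ Ω))
      {z | ‖z.1‖ ^ υ / z.2 ≤ t} = ENNReal.ofReal (A1 d υ lam α μ Ω * t ^ (d / υ)) := by
  have hc := unitBallVolume_pos d
  -- For a fixed gain `γ > 0` the section is a ball of radius `(t * γ) ^ υ⁻¹`, so locations are
  -- integrated first.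
  rw [Measure.prod_apply_symm (measurableSet_fadedPathLoss_le d υ t)]
  have h1 : ∀ᵐ γ ∂(alphaMuLaw α μ Ω),
      (ENNReal.ofReal lam • (volume : Measure (EuclideanSpace ℝ (Fin d))))
        ((fun x => (x, γ)) ⁻¹' {z | ‖z.1‖ ^ υ / z.2 ≤ t})
      = ENNReal.ofReal (lam * unitBallVolume d * t ^ (d / υ)) * ENNReal.ofReal (γ ^ (d / υ)) := by
    filter_upwards [ae_pos_alphaMuLaw α μ Ω] with γ hγ
    have : (fun x : EuclideanSpace ℝ (Fin d) => (x, γ)) ⁻¹' {z | ‖z.1‖ ^ υ / z.2 ≤ t}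
        = {x | ‖x‖ ^ υ ≤ t * γ} := by
      ext x
      simp [div_le_iff₀ hγ]
    rw [this, Measure.smul_apply, volume_setOf_norm_rpow_le d hd hυ (by positivity), smul_eq_mul,
      ← ENNReal.ofReal_mul hlam.le, ← ENNReal.ofReal_mul (by positivity), Real.mul_rpow ht hγ.le]
    congr 1; ring
  rw [lintegral_congr_ae h1, lintegral_const_mul _ (by fun_prop),
    lintegral_rpow_alphaMuLaw hα hμ hΩ (by positivity), ← ENNReal.ofReal_mul (by positivity),
    A1_eq hd hυ]
  congr 1; ring

/-! ### Order statistics of a sequence and their measurability. -/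

/-- Sequences of positive numbers that tend to `∞`. -/
def IsProperSeq (ξ : ℕ → ℝ) : Prop :=
  (∀ n : ℕ, {i | ξ i ≤ n}.encard ≠ ⊤) ∧ (∀ k : ℕ, ∃ n : ℕ, (k : ℕ∞) ≤ {i | ξ i ≤ n}.encard) ∧
    {i | ξ i ≤ (0 : ℕ)}.encard = 0

lemma IsProperSeq.pos {ξ : ℕ → ℝ} (h : IsProperSeq ξ) (i : ℕ) : 0 < ξ i := by
  by_contra hi
  have h0 : i ∈ {i | ξ i ≤ (0 : ℕ)} := by simpa using hi
  rw [Set.encard_eq_zero.1 h.2.2] at h0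
  exact h0

lemma IsProperSeq.finite {ξ : ℕ → ℝ} (h : IsProperSeq ξ) (t : ℝ) : {i | ξ i ≤ t}.Finite := by
  obtain ⟨n, hn⟩ := exists_nat_ge t
  exact (Set.encard_ne_top_iff.1 (h.1 n)).subset fun i hi => le_trans hi hn

/-- The counting function is a right-continuous step function, so the infimum is attained.
Positivity of the terms and `1 ≤ k` bound the set below by `0`. -/
lemma IsProperSeq.kthSmallest_le_iff {ξ : ℕ → ℝ} (h : IsProperSeq ξ) {k : ℕ} (hk : 1 ≤ k) (t : ℝ) :
    kthSmallest ξ k ≤ t ↔ (k : ℕ∞) ≤ {i | ξ i ≤ t}.encard := by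
  constructor
  · intro hle
    by_contra hlt
    -- Only finitely many terms are at most `t + 1`, so some interval to the right of `t` contains
    -- no term.
    obtain ⟨t', htt', ht'⟩ : ∃ t', t < t' ∧ ∀ i, ξ i < t' → ξ i ≤ t := by
      have hfin : {x | t < x ∧ x ∈ ξ '' {i | ξ i ≤ t + 1}}.Finite :=
        ((h.finite (t + 1)).image ξ).subset fun x hx => hx.2
      obtain ⟨ε, hε, hball⟩ := Metric.eventually_nhds_iff.1
        (hfin.isClosed.isOpen_compl.eventually_mem (x := t) fun hx => lt_irrefl _ hx.1)
      refine ⟨min (t + ε) (t + 1), by simp [hε], fun i hi => ?_⟩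
      by_contra hti
      push Not at hti
      have h1 := hi.trans_le (min_le_left _ _)
      have h2 := hi.trans_le (min_le_right _ _)
      refine hball (y := ξ i) ?_ ⟨hti, i, h2.le, rfl⟩
      rw [Real.dist_eq, abs_of_pos (by linarith)]
      linarith
    have hne : {s : ℝ | (k : ℕ∞) ≤ {i : ℕ | ξ i ≤ s}.encard}.Nonempty := by
      obtain ⟨n, hn⟩ := h.2.1 k
      exact ⟨n, hn⟩
    obtain ⟨s, hs, hst⟩ := exists_lt_of_csInf_lt hne (hle.trans_lt htt')
    exact hlt (le_trans hs (Set.encard_le_encard fun i hi => ht' i (lt_of_le_of_lt hi hst)))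
  · intro hle
    refine csInf_le ⟨0, fun s hs => ?_⟩ hle
    have hne : {i | ξ i ≤ s}.Nonempty := by
      rw [← Set.one_le_encard_iff_nonempty]
      exact le_trans (by exact_mod_cast hk) hs
    obtain ⟨i, hi⟩ := hne
    exact (h.pos i).le.trans hi

lemma IsProperSeq.kthSmallest_pos {ξ : ℕ → ℝ} (h : IsProperSeq ξ) {k : ℕ} (hk : 1 ≤ k) :
    0 < kthSmallest ξ k := by
  by_contra hle
  rw [not_lt, h.kthSmallest_le_iff hk] at hle
  have h0 := h.2.2
  rw [Nat.cast_zero] at h0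
  rw [h0] at hle
  have : (k : ℕ∞) = 0 := le_antisymm hle zero_le
  have : k = 0 := by exact_mod_cast this
  omega

lemma measurable_encard_setOf_le (t : ℝ) : Measurable fun ξ : ℕ → ℝ => {i | ξ i ≤ t}.encard :=
  measurable_encard.comp (measurable_set_iff.2 fun i =>
    measurableSet_setOfPred.1 (measurableSet_le (measurable_pi_apply i) measurable_const))

/-- The thresholds in `IsProperSeq` are natural numbers, which makes this a countable combination of
events about counts. -/
lemma measurableSet_isProperSeq : MeasurableSet {ξ | IsProperSeq ξ} := by
  have : {ξ : ℕ → ℝ | IsProperSeq ξ} =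
      (⋂ n : ℕ, {ξ : ℕ → ℝ | {i | ξ i ≤ (n : ℝ)}.encard ∈ ({⊤}ᶜ : Set ℕ∞)}) ∩
      ((⋂ k : ℕ, ⋃ n : ℕ, {ξ : ℕ → ℝ | {i | ξ i ≤ (n : ℝ)}.encard ∈ Set.Ici (k : ℕ∞)}) ∩
        {ξ : ℕ → ℝ | {i | ξ i ≤ ((0 : ℕ) : ℝ)}.encard ∈ ({0} : Set ℕ∞)}) := by
    ext ξ
    simp only [IsProperSeq, Set.mem_inter_iff, Set.mem_iInter, Set.mem_iUnion, Set.mem_ofPred_eq,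
      Set.mem_compl_iff, Set.mem_singleton_iff, Set.mem_Ici, ne_eq]
  rw [this]
  exact (MeasurableSet.iInter fun n : ℕ => measurable_encard_setOf_le n .of_discrete).inter
    ((MeasurableSet.iInter fun k : ℕ => MeasurableSet.iUnion fun n : ℕ =>
       measurable_encard_setOf_le n .of_discrete).inter
      (measurable_encard_setOf_le (0 : ℕ) .of_discrete))

open Classical in
/-- A measurable version of `kthSmallest`. -/
noncomputable def kthSmallestProper (k : ℕ) (ξ : ℕ → ℝ) : ℝ :=
  if IsProperSeq ξ then kthSmallest ξ k else 0

lemma measurable_kthSmallestProper {k : ℕ} (hk : 1 ≤ k) : Measurable (kthSmallestProper k) := by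
  refine measurable_of_Iic fun t => ?_
  have : kthSmallestProper k ⁻¹' Set.Iic t
      = ({ξ | IsProperSeq ξ} ∩ {ξ | (k : ℕ∞) ≤ {i | ξ i ≤ t}.encard})
        ∪ ({ξ | IsProperSeq ξ}ᶜ ∩ {_ξ | 0 ≤ t}) := by
    ext ξ
    by_cases h : IsProperSeq ξ
    · simp [kthSmallestProper, h, h.kthSmallest_le_iff hk]
    · simp [kthSmallestProper, h]
  rw [this]
  exact (measurableSet_isProperSeq.inter
    (measurable_encard_setOf_le t (.of_discrete (s := Set.Ici (k : ℕ∞))))).union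
    (measurableSet_isProperSeq.compl.inter (.const _))

lemma measurable_fadedPathLoss {S : Type*} [MeasurableSpace S] {d : ℕ} {υ : ℝ}
    {X : ℕ → S → EuclideanSpace ℝ (Fin d)} {g : ℕ → S → ℝ} (hX : ∀ i, Measurable (X i))
    (hg : ∀ i, Measurable (g i)) : Measurable (fadedPathLoss υ X g) := by
  refine measurable_pi_lambda _ fun i => ?_
  have := hX i
  have := hg i
  unfold fadedPathLoss
  fun_prop

/-! ### Distribution of the ordered path losses. -/

/-- Probability that a Poisson variable with mean `x` is less than `k`. -/
noncomputable def poissonLT (k : ℕ) (x : ℝ) : ℝ :=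
  ∑ j ∈ Finset.range k, Real.exp (-x) * x ^ j / j.factorial

lemma tendsto_poissonLT_atTop (k : ℕ) : Tendsto (poissonLT k) atTop (𝓝 0) := by
  have : Tendsto (poissonLT k) atTop (𝓝 (∑ j ∈ Finset.range k, (0 : ℝ) / j.factorial)) := by
    refine tendsto_finsetSum _ fun j _ => ?_
    refine Tendsto.div_const ?_ _
    simpa [mul_comm] using Real.tendsto_pow_mul_exp_neg_atTop_nhds_zero j
  simpa using this

section Population

variable {S : Type*} [MeasurableSpace S] {P : Measure S} [IsProbabilityMeasure P] {d : ℕ}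
  {υ lam α μ Ω : ℝ} {X : ℕ → S → EuclideanSpace ℝ (Fin d)} {g : ℕ → S → ℝ}

/-- The number of receivers with faded path loss at most `t` is Poisson distributed. -/
lemma IsFadingPopulation.hasLaw_encard (hd : 1 ≤ d) (hυ : 0 < υ) (hlam : 0 < lam) (hα : 0 < α)
    (hμ : 0 < μ) (hΩ : 0 < Ω) (h : IsFadingPopulation P d lam α μ Ω X g) {t : ℝ} (ht : 0 ≤ t) :
    HasLaw (fun ω => {i | fadedPathLoss υ X g ω i ≤ t}.encard)
      ((poissonMeasure (A1 d υ lam α μ Ω * t ^ (d / υ)).toNNReal).map (Nat.cast : ℕ → ℕ∞)) P := by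
  -- No integral of the density is needed: this measure is the law of a random variable.
  have hν : IsProbabilityMeasure (alphaMuLaw α μ Ω) :=
    (h.law_gain 0).isProbabilityMeasure_iff.1 inferInstance
  have hI := intensity_fadedPathLoss_le hd hυ hlam hα hμ hΩ ht
  have hσ : SigmaFinite (ENNReal.ofReal lam • (volume : Measure (EuclideanSpace ℝ (Fin d)))) :=
    inferInstanceAs (SigmaFinite (lam.toNNReal • (volume : Measure (EuclideanSpace ℝ (Fin d)))))
  have := h.locations.hasLaw_pointCount_marked h.measurable_gain h.law_gain h.indep_gain
    h.indep_locations_gain (measurableSet_fadedPathLoss_le d υ t)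
    (by rw [hI]; exact ENNReal.ofReal_ne_top)
  rw [hI] at this
  exact this

lemma map_poissonMeasure_real (r : ℝ≥0) (B : Set ℕ∞) :
    ((poissonMeasure r).map (Nat.cast : ℕ → ℕ∞)).real B = (poissonMeasure r).real (Nat.cast ⁻¹' B) :=
  map_measureReal_apply .of_discrete .of_discrete

lemma poissonMeasure_real_lt (r : ℝ≥0) (k : ℕ) :
    (poissonMeasure r).real {n | n < k} = poissonLT k r := by
  have : {n | n < k} = ((Finset.range k : Finset ℕ) : Set ℕ) := by ext; simp
  rw [this, ← sum_measureReal_singleton, poissonLT]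
  exact Finset.sum_congr rfl fun j _ => poissonMeasure_real_singleton r j

lemma IsFadingPopulation.measureReal_encard_lt (hd : 1 ≤ d) (hυ : 0 < υ) (hlam : 0 < lam)
    (hα : 0 < α) (hμ : 0 < μ) (hΩ : 0 < Ω) (h : IsFadingPopulation P d lam α μ Ω X g) {t : ℝ}
    (ht : 0 ≤ t) (k : ℕ) :
    P.real {ω | {i | fadedPathLoss υ X g ω i ≤ t}.encard < k}
      = poissonLT k (A1 d υ lam α μ Ω * t ^ (d / υ)) := by
  have hA := A1_pos hd hυ hlam hα hμ hΩ
  rw [(h.hasLaw_encard hd hυ hlam hα hμ hΩ ht).measureReal_eq (p := fun n => n < k) .of_discrete,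
    map_poissonMeasure_real]
  have : (Nat.cast ⁻¹' {n : ℕ∞ | n < k} : Set ℕ) = {n | n < k} := by ext; simp
  rw [this, poissonMeasure_real_lt, Real.coe_toNNReal _ (by positivity)]

/-- Poisson counts are finite, exceed any `k` as their mean grows, and vanish at `t = 0`, where the
mean is zero because `δ > 0`. -/
lemma IsFadingPopulation.ae_isProperSeq (hd : 1 ≤ d) (hυ : 0 < υ) (hlam : 0 < lam)
    (hα : 0 < α) (hμ : 0 < μ) (hΩ : 0 < Ω) (h : IsFadingPopulation P d lam α μ Ω X g) :
    ∀ᵐ ω ∂P, IsProperSeq (fadedPathLoss υ X g ω) := by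
  have hA := A1_pos hd hυ hlam hα hμ hΩ
  have hδ : (0 : ℝ) < d / υ := div_pos (by exact_mod_cast hd) hυ
  refine .and (ae_all_iff.2 fun n => ?_) (.and (ae_all_iff.2 fun k => ?_) ?_)
  · refine ((h.hasLaw_encard (t := n) hd hυ hlam hα hμ hΩ n.cast_nonneg).ae_iff
      (p := fun n => n ≠ ⊤) .of_discrete).2 ?_
    rw [ae_map_iff .of_discrete .of_discrete]
    exact .of_forall fun n => ENat.natCast_ne_top n
  · have hlim : Tendsto (fun n : ℕ => poissonLT k (A1 d υ lam α μ Ω * (n : ℝ) ^ (d / υ))) atTop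
        (𝓝 0) :=
      (tendsto_poissonLT_atTop k).comp (Tendsto.const_mul_atTop hA
        ((tendsto_rpow_atTop hδ).comp tendsto_natCast_atTop_atTop))
    have hle : ∀ n : ℕ, P.real {ω | ¬ ∃ n : ℕ,
        (k : ℕ∞) ≤ {i | fadedPathLoss υ X g ω i ≤ n}.encard}
        ≤ poissonLT k (A1 d υ lam α μ Ω * (n : ℝ) ^ (d / υ)) := fun n => by
      rw [← h.measureReal_encard_lt hd hυ hlam hα hμ hΩ n.cast_nonneg]
      refine measureReal_mono fun ω hω => ?_
      simp only [Set.mem_ofPred_eq, not_exists, not_le] at hω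
      exact hω n
    have h0 := le_antisymm (ge_of_tendsto' hlim hle) measureReal_nonneg
    rw [measureReal_eq_zero_iff] at h0
    exact h0
  · have := h.measureReal_encard_lt (υ := υ) hd hυ hlam hα hμ hΩ le_rfl 1
    rw [Real.zero_rpow hδ.ne', mul_zero] at this
    have h1 : P.real {ω | {i | fadedPathLoss υ X g ω i ≤ (0 : ℕ)}.encard = 0} = 1 := by
      simpa [poissonLT, Order.lt_one_iff] using this
    have hm : MeasurableSet {ω | {i | fadedPathLoss υ X g ω i ≤ (0 : ℕ)}.encard = 0} :=
      (measurable_encard_setOf_le (0 : ℕ)).comp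
        (measurable_fadedPathLoss h.locations.measurable h.measurable_gain) (.of_discrete (s := {0}))
    exact (prob_compl_eq_zero_iff hm).2 (by
      rw [measureReal_def, ENNReal.toReal_eq_one_iff] at h1; exact h1)

/-- Tail of the `k`-th smallest faded path loss. -/
lemma IsFadingPopulation.measureReal_lt_kthSmallestProper (hd : 1 ≤ d) (hυ : 0 < υ)
    (hlam : 0 < lam) (hα : 0 < α) (hμ : 0 < μ) (hΩ : 0 < Ω)
    (h : IsFadingPopulation P d lam α μ Ω X g) {t : ℝ} (ht : 0 ≤ t) {k : ℕ} (hk : 1 ≤ k) :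
    P.real {ω | t < kthSmallestProper k (fadedPathLoss υ X g ω)}
      = poissonLT k (A1 d υ lam α μ Ω * t ^ (d / υ)) := by
  rw [← h.measureReal_encard_lt hd hυ hlam hα hμ hΩ ht]
  refine measureReal_congr ?_
  filter_upwards [h.ae_isProperSeq hd hυ hlam hα hμ hΩ (υ := υ)] with ω hω
  refine propext ?_
  change t < kthSmallestProper k _ ↔ _ < _
  rw [kthSmallestProper, if_pos hω, ← not_le, hω.kthSmallest_le_iff hk, not_le]

end Population

/-! ### Laplace transform of the Erlang law. -/

lemma integral_pow_mul_exp_neg_mul (j : ℕ) {r : ℝ} (hr : 0 < r) :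
    ∫ v in Set.Ioi (0 : ℝ), v ^ j * Real.exp (-(r * v)) = j.factorial / r ^ (j + 1) := by
  have := Real.integral_rpow_mul_exp_neg_mul_Ioi (a := j + 1) (by positivity) hr
  rw [Real.Gamma_nat_eq_factorial, add_sub_cancel_right] at this
  simp_rw [Real.rpow_natCast] at this
  rw [this, ← Nat.cast_succ, Real.rpow_natCast, one_div, inv_pow]
  field_simp

lemma integrableOn_pow_mul_exp_neg_mul (j : ℕ) {r : ℝ} (hr : 0 < r) :
    IntegrableOn (fun v : ℝ => v ^ j * Real.exp (-(r * v))) (Set.Ioi 0) := by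
  -- A non-integrable function has Bochner integral `0` by convention, so a nonzero value proves
  -- integrability.
  refine Integrable.of_integral_ne_zero ?_
  rw [integral_pow_mul_exp_neg_mul j hr]
  positivity

/-- Passing from `k` to `k + 1` subtracts `c / (1 + c) ^ (k + 1)`, and `(1 + c) ^ (-k) - c * (1 + c)
^ (-k - 1) = (1 + c) ^ (-k - 1)`. -/
lemma hasIntegral_poissonLT_mul_exp (k : ℕ) {c : ℝ} (hc : 0 < c) :
    IntegrableOn (fun v => (1 - poissonLT k v) * (c * Real.exp (-(c * v)))) (Set.Ioi 0) ∧
      ∫ v in Set.Ioi (0 : ℝ), (1 - poissonLT k v) * (c * Real.exp (-(c * v)))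
        = (1 / (1 + c)) ^ k := by
  have hexp : ∀ (k : ℕ) (v : ℝ), (1 - poissonLT (k + 1) v) * (c * Real.exp (-(c * v)))
      = (1 - poissonLT k v) * (c * Real.exp (-(c * v)))
        - (c / k.factorial) * (v ^ k * Real.exp (-((1 + c) * v))) := fun k v => by
    rw [poissonLT, Finset.sum_range_succ, ← poissonLT,
      show -((1 + c) * v) = -v + -(c * v) by ring, Real.exp_add]
    ring
  induction k with
  | zero =>
    have h0 := (integrableOn_pow_mul_exp_neg_mul 0 hc).const_mul c
    have h1 := integral_pow_mul_exp_neg_mul 0 hc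
    simp only [pow_zero, one_mul, Nat.factorial_zero, Nat.cast_one, zero_add, pow_one] at h0 h1
    simp only [poissonLT, Finset.range_zero, Finset.sum_empty, sub_zero, one_mul, pow_zero]
    refine ⟨h0, ?_⟩
    rw [integral_const_mul, h1]
    field_simp
  | succ k ih =>
    have h0 := (integrableOn_pow_mul_exp_neg_mul k (r := 1 + c) (by positivity)).const_mul
      (c / k.factorial)
    simp_rw [hexp]
    refine ⟨ih.1.sub h0, ?_⟩
    rw [integral_sub ih.1 h0, ih.2, integral_const_mul,
      integral_pow_mul_exp_neg_mul k (by positivity)]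
    have : (k.factorial : ℝ) ≠ 0 := by positivity
    have hc1 : (1 + c) ≠ 0 := by positivity
    rw [one_div, inv_pow, inv_pow, pow_succ]
    field_simp
    ring

/-- Laplace transform of the Erlang distribution. -/
lemma lintegral_exp_neg_erlang {S : Type*} [MeasurableSpace S] {P : Measure S}
    [IsProbabilityMeasure P] {W : S → ℝ} (hW : Measurable W) (hW0 : ∀ ω, 0 ≤ W ω) {k : ℕ}
    (h : ∀ v, 0 ≤ v → P.real {ω | v < W ω} = poissonLT k v) {c : ℝ} (hc : 0 < c) :
    ∫⁻ ω, ENNReal.ofReal (Real.exp (-(c * W ω))) ∂P = ENNReal.ofReal ((1 / (1 + c)) ^ k) := by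
  -- `exp (-c w)` is the mass of `[w, ∞)` under the exponential law of rate `c`; Tonelli then leaves
  -- only the distribution function of `W`.
  have hlay : ∀ w : ℝ, 0 ≤ w → ENNReal.ofReal (Real.exp (-(c * w)))
      = ∫⁻ v in Set.Ioi (0 : ℝ),
        {p : ℝ × ℝ | p.1 ≤ p.2}.indicator
          (fun p => ENNReal.ofReal (c * Real.exp (-(c * p.2)))) (w, v) := by
    intro w hw
    have h1 : ∀ v : ℝ, {p : ℝ × ℝ | p.1 ≤ p.2}.indicator
        (fun p => ENNReal.ofReal (c * Real.exp (-(c * p.2)))) (w, v)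
        = (Set.Ici w).indicator (fun v => ENNReal.ofReal (c * Real.exp (-(c * v)))) v := by
      intro v
      simp [Set.indicator_apply]
    have h2 : IntegrableOn (fun v => c * Real.exp (-(c * v))) (Set.Ioi w) := by
      have := (integrableOn_exp_mul_Ioi (neg_lt_zero.2 hc) w).const_mul c
      simp only [neg_mul] at this
      exact this
    have h3 : ∫ v in Set.Ioi w, c * Real.exp (-(c * v)) = Real.exp (-(c * w)) := by
      have := integral_exp_mul_Ioi (neg_lt_zero.2 hc) w
      simp only [neg_mul] at this
      rw [integral_const_mul, this]
      field_simp
    simp_rw [h1]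
    rw [lintegral_congr_ae (ae_restrict_of_ae (indicator_ae_eq_of_ae_eq_set Ioi_ae_eq_Ici.symm)),
      lintegral_indicator measurableSet_Ioi, Measure.restrict_restrict measurableSet_Ioi,
      Set.inter_eq_left.2 (Set.Ioi_subset_Ioi hw), ← ofReal_integral_eq_lintegral_ofReal h2
        (.of_forall fun v => by simp only [Pi.zero_apply]; positivity), h3]
  simp_rw [fun ω => hlay (W ω) (hW0 ω)]
  have hm : Measurable ({p : ℝ × ℝ | p.1 ≤ p.2}.indicator
      (fun p => ENNReal.ofReal (c * Real.exp (-(c * p.2))))) :=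
    Measurable.indicator (by fun_prop) (measurableSet_le measurable_fst measurable_snd)
  have hmW : Measurable fun p : S × ℝ => (W p.1, p.2) := by fun_prop
  rw [lintegral_lintegral_swap (f := fun ω v => {p : ℝ × ℝ | p.1 ≤ p.2}.indicator
    (fun p => ENNReal.ofReal (c * Real.exp (-(c * p.2)))) (W ω, v)) (hm.comp hmW).aemeasurable]
  obtain ⟨hi, hv⟩ := hasIntegral_poissonLT_mul_exp k hc
  rw [← hv, ofReal_integral_eq_lintegral_ofReal hi]
  · refine setLIntegral_congr_fun measurableSet_Ioi fun v hv => ?_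
    have hmW : MeasurableSet {ω | W ω ≤ v} := measurableSet_le hW measurable_const
    have h1 : ∀ ω, {p : ℝ × ℝ | p.1 ≤ p.2}.indicator
        (fun p => ENNReal.ofReal (c * Real.exp (-(c * p.2)))) (W ω, v)
        = {ω | W ω ≤ v}.indicator (fun _ => ENNReal.ofReal (c * Real.exp (-(c * v)))) ω := by
      intro ω
      simp [Set.indicator_apply]
    have h2 : P.real {ω | W ω ≤ v} = 1 - poissonLT k v := by
      rw [← h v (le_of_lt hv), ← probReal_compl_eq_one_sub (measurableSet_lt measurable_const hW)]
      congr 1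
      ext ω
      simp
    simp_rw [h1]
    rw [lintegral_indicator_const hmW, ← ofReal_measureReal, h2,
      ← ENNReal.ofReal_mul (by positivity), mul_comm]
  · filter_upwards [ae_restrict_mem measurableSet_Ioi] with v hv
    have : poissonLT k v ≤ 1 := h v (le_of_lt hv) ▸ measureReal_le_one
    exact mul_nonneg (sub_nonneg.2 this) (by positivity)

lemma kthSmallestProper_nonneg {k : ℕ} (hk : 1 ≤ k) (ξ : ℕ → ℝ) : 0 ≤ kthSmallestProper k ξ := by
  unfold kthSmallestProper
  split_ifs with h
  · exact (h.kthSmallest_pos hk).le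
  · exact le_rfl

lemma measure_lt_mul_eq_lintegral {S : Type*} [MeasurableSpace S] {P : Measure S}
    [IsProbabilityMeasure P] {U V : S → ℝ} (hU : Measurable U) (hV : Measurable V)
    (hUV : IndepFun U V P) (a : ℝ) :
    P {ω | U ω < a * V ω} = ∫⁻ ω, P {ω' | U ω < a * V ω'} ∂P := by
  have hD : MeasurableSet {p : ℝ × ℝ | p.1 < a * p.2} :=
    measurableSet_lt measurable_fst (by fun_prop)
  have h1 : P {ω | U ω < a * V ω} = (P.map fun ω => (U ω, V ω)) {p : ℝ × ℝ | p.1 < a * p.2} := by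
    rw [Measure.map_apply (hU.prodMk hV) hD]; rfl
  rw [h1, (indepFun_iff_map_prod_eq_prod_map_map hU.aemeasurable hV.aemeasurable).1 hUV,
    Measure.prod_apply hD, lintegral_map (measurable_measure_prodMk_left hD) hU]
  refine lintegral_congr fun ω => ?_
  rw [Measure.map_apply hV (measurable_prodMk_left hD)]
  rfl

/-! ### The power formula and the resulting thresholds. -/

/-- Probability of non-zero secrecy capacity of the `k`-th best receiver. -/
theorem probNonzeroBB_eq_pow {S : Type*} [MeasurableSpace S] {P : Measure S}
    [IsProbabilityMeasure P] {d : ℕ} (hd : 1 ≤ d) {υ : ℝ} (hυ : 0 < υ)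
    {lamb αb μb Ωb : ℝ} (hlamb : 0 < lamb) (hαb : 0 < αb) (hμb : 0 < μb) (hΩb : 0 < Ωb)
    {lame αe μe Ωe : ℝ} (hlame : 0 < lame) (hαe : 0 < αe) (hμe : 0 < μe) (hΩe : 0 < Ωe)
    {ηb ηe : ℝ} (hηb : 0 < ηb) (hηe : 0 < ηe)
    {X : ℕ → S → EuclideanSpace ℝ (Fin d)} {g : ℕ → S → ℝ}
    {Y : ℕ → S → EuclideanSpace ℝ (Fin d)} {h : ℕ → S → ℝ}
    (hb : IsFadingPopulation P d lamb αb μb Ωb X g)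
    (he : IsFadingPopulation P d lame αe μe Ωe Y h)
    (hind : IndepFun (fun ω (i : ℕ) => (X i ω, g i ω)) (fun ω (i : ℕ) => (Y i ω, h i ω)) P)
    {k : ℕ} (hk : 1 ≤ k) :
    probNonzeroBB P ηb ηe (fadedPathLoss υ X g) (fadedPathLoss υ Y h) k
      = (A1 d υ lamb αb μb Ωb / (A1 d υ lamb αb μb Ωb
        + A1 d υ lame αe μe Ωe * (ηb / ηe) ^ (-((d : ℝ) / υ)))) ^ k := by
  have hA := A1_pos hd hυ hlamb hαb hμb hΩb
  have hB := A1_pos hd hυ hlame hαe hμe hΩe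
  have hδ : (0 : ℝ) < d / υ := div_pos (by exact_mod_cast hd) hυ
  have hϖ : 0 < ηb / ηe := div_pos hηb hηe
  set A := A1 d υ lamb αb μb Ωb
  set B := A1 d υ lame αe μe Ωe
  set δ : ℝ := d / υ
  set ϖ := ηb / ηe with hϖdef
  let U : S → ℝ := fun ω => kthSmallestProper k (fadedPathLoss υ X g ω)
  let V : S → ℝ := fun ω => kthSmallestProper 1 (fadedPathLoss υ Y h ω)
  have hU : Measurable U := (measurable_kthSmallestProper hk).comp
    (measurable_fadedPathLoss hb.locations.measurable hb.measurable_gain)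
  have hV : Measurable V := (measurable_kthSmallestProper le_rfl).comp
    (measurable_fadedPathLoss he.locations.measurable he.measurable_gain)
  have hU0 : ∀ ω, 0 ≤ U ω := fun ω => kthSmallestProper_nonneg hk _
  have hloss : Measurable fun (z : ℕ → EuclideanSpace ℝ (Fin d) × ℝ) (i : ℕ) =>
      ‖(z i).1‖ ^ υ / (z i).2 := by fun_prop
  have hUV : IndepFun U V P := hind.comp ((measurable_kthSmallestProper hk).comp hloss)
    ((measurable_kthSmallestProper le_rfl).comp hloss)
  have hcongr : probNonzeroBB P ηb ηe (fadedPathLoss υ X g) (fadedPathLoss υ Y h) k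
      = P.real {ω | U ω < ϖ * V ω} := by
    refine measureReal_congr ?_
    filter_upwards [hb.ae_isProperSeq hd hυ hlamb hαb hμb hΩb (υ := υ),
      he.ae_isProperSeq hd hυ hlame hαe hμe hΩe (υ := υ)] with ω h1 h2
    refine propext ?_
    change ηe / kthSmallest _ 1 < ηb / kthSmallest _ k ↔ kthSmallestProper k _
      < ϖ * kthSmallestProper 1 _
    rw [kthSmallestProper, kthSmallestProper, if_pos h1, if_pos h2,
      div_lt_div_iff₀ (h2.kthSmallest_pos le_rfl) (h1.kthSmallest_pos hk), hϖdef,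
      div_mul_eq_mul_div, lt_div_iff₀ hηe, mul_comm ηe]
  -- The exponent is arranged as a constant times the Erlang variable `A * U ω ^ δ`.
  have htail : ∀ ω, P {ω' | U ω < ϖ * V ω'}
      = ENNReal.ofReal (Real.exp (-(B * ϖ ^ (-δ) / A * (A * U ω ^ δ)))) := by
    intro ω
    have h1 : {ω' | U ω < ϖ * V ω'} = {ω' | U ω / ϖ < V ω'} := by
      ext ω'
      simp only [Set.mem_ofPred_eq, div_lt_iff₀' hϖ]
    have h2 := he.measureReal_lt_kthSmallestProper (t := U ω / ϖ) (k := 1) hd hυ hlame hαe hμe hΩe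
      (div_nonneg (hU0 ω) hϖ.le) le_rfl
    rw [h1, ← ofReal_measureReal, h2]
    simp only [poissonLT, Finset.range_one, Finset.sum_singleton, pow_zero, Nat.factorial_zero,
      Nat.cast_one, mul_one, div_one]
    congr 3
    change B * (U ω / ϖ) ^ δ = _
    rw [Real.div_rpow (hU0 ω) hϖ.le, Real.rpow_neg hϖ.le]
    field_simp
  have hc : 0 < B * ϖ ^ (-δ) / A := by positivity
  have hW := lintegral_exp_neg_erlang (P := P) (W := fun ω => A * U ω ^ δ) (k := k) (by fun_prop)
    (fun ω => mul_nonneg hA.le (Real.rpow_nonneg (hU0 ω) _)) (fun v hv => by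
      have hvA : 0 ≤ v / A := div_nonneg hv hA.le
      have h1 : {ω | v < A * U ω ^ δ} = {ω | (v / A) ^ δ⁻¹ < U ω} := by
        ext ω
        simp only [Set.mem_ofPred_eq, Real.rpow_inv_lt_iff_of_pos hvA (hU0 ω) hδ,
          div_lt_iff₀' hA]
      have h2 := hb.measureReal_lt_kthSmallestProper (υ := υ) (t := (v / A) ^ δ⁻¹) hd hυ hlamb hαb
        hμb hΩb (Real.rpow_nonneg hvA _) hk
      rw [h1]
      refine h2.trans ?_
      rw [Real.rpow_inv_rpow hvA hδ.ne', mul_div_cancel₀ _ hA.ne']) hc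
  rw [hcongr, measureReal_def, measure_lt_mul_eq_lintegral hU hV hUV, lintegral_congr htail, hW,
    ENNReal.toReal_ofReal (by positivity)]
  congr 1
  field_simp

/-- For `0 < b < 1` the powers `b ^ k` that are at least `τ` are those with `k ≤ logb b τ`. -/
lemma pow_logb_threshold {b : ℝ} (hb0 : 0 < b) (hb1 : b < 1) {F : ℕ → ℝ}
    (hF : ∀ k : ℕ, 1 ≤ k → F k = b ^ k) {τ : ℝ} (hτ0 : 0 < τ) (hτ1 : τ ≤ 1) :
    (∀ k : ℕ, 1 ≤ k → (F k = τ ↔ (k : ℝ) = Real.logb b τ)) ∧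
      (∀ k : ℕ, 1 ≤ k → (τ ≤ F k ↔ (k : ℝ) ≤ Real.logb b τ)) ∧
      IsGreatest {K : ℕ | ∀ k : ℕ, 1 ≤ k → k ≤ K → τ ≤ F k} ⌊Real.logb b τ⌋₊ := by
  have hle : ∀ k : ℕ, 1 ≤ k → (τ ≤ F k ↔ (k : ℝ) ≤ Real.logb b τ) := fun k hk => by
    rw [hF k hk, Real.le_logb_iff_rpow_le_of_base_lt_one hb0 hb1 hτ0, Real.rpow_natCast]
  -- Nonnegativity is what `Nat.le_floor_iff` requires; this is where `τ ≤ 1` enters.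
  have hlog : 0 ≤ Real.logb b τ := Real.logb_nonneg_of_base_lt_one hb0 hb1 hτ0 hτ1
  refine ⟨fun k hk => ?_, hle, fun k hk hkK => (hle k hk).2 ((Nat.le_floor_iff hlog).1 hkK),
    fun K hK => ?_⟩
  · rw [hF k hk, eq_comm (a := (k : ℝ)), Real.logb_eq_iff_rpow_eq hb0 hb1.ne hτ0,
      Real.rpow_natCast]
  -- `K = 0` imposes no condition on receivers, so it is split off before `hle` is applied at `k =
  -- K`.
  · rcases Nat.eq_zero_or_pos K with rfl | hK0
    · exact Nat.zero_le _
    · exact Nat.le_floor ((hle K hK0).1 (hK K hK0 le_rfl))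

end SecrecyNet

theorem mainTheorem9 {S : Type*} [MeasurableSpace S] (P : Measure S) [IsProbabilityMeasure P]
    (d : ℕ) (hd : 1 ≤ d) (υ : ℝ) (hυ : 0 < υ)
    (lamb αb μb Ωb : ℝ) (hlamb : 0 < lamb) (hαb : 0 < αb) (hμb : 0 < μb) (hΩb : 0 < Ωb)
    (lame αe μe Ωe : ℝ) (hlame : 0 < lame) (hαe : 0 < αe) (hμe : 0 < μe) (hΩe : 0 < Ωe)
    (ηb ηe : ℝ) (hηb : 0 < ηb) (hηe : 0 < ηe)
    (X : ℕ → S → EuclideanSpace ℝ (Fin d)) (g : ℕ → S → ℝ)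
    (Y : ℕ → S → EuclideanSpace ℝ (Fin d)) (h : ℕ → S → ℝ)
    (hb : SecrecyNet.IsFadingPopulation P d lamb αb μb Ωb X g)
    (he : SecrecyNet.IsFadingPopulation P d lame αe μe Ωe Y h)
    (hind : IndepFun (fun ω (i : ℕ) => (X i ω, g i ω)) (fun ω (i : ℕ) => (Y i ω, h i ω)) P) :
    let Ab1 := SecrecyNet.A1 d υ lamb αb μb Ωb
    let Ae1 := SecrecyNet.A1 d υ lame αe μe Ωe
    let b := Ab1 / (Ab1 + Ae1 * (ηb / ηe) ^ (-((d : ℝ) / υ)))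
    let Pnz := SecrecyNet.probNonzeroBB P ηb ηe
      (SecrecyNet.fadedPathLoss υ X g) (SecrecyNet.fadedPathLoss υ Y h)
    -- outage form: the probability `1 - Pnz k` must not exceed `τ`
    (∀ τ : ℝ, 0 ≤ τ → τ < 1 →
      (∀ k : ℕ, 1 ≤ k → (1 - Pnz k = τ ↔ (k : ℝ) = Real.logb b (1 - τ))) ∧
      (∀ k : ℕ, 1 ≤ k → (1 - Pnz k ≤ τ ↔ (k : ℝ) ≤ Real.logb b (1 - τ))) ∧
      IsGreatest {K : ℕ | ∀ k : ℕ, 1 ≤ k → k ≤ K → 1 - Pnz k ≤ τ} ⌊Real.logb b (1 - τ)⌋₊) ∧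
    -- reliability form: the probability `Pnz k` must be at least `τ`
    (∀ τ : ℝ, 0 < τ → τ ≤ 1 →
      (∀ k : ℕ, 1 ≤ k → (Pnz k = τ ↔ (k : ℝ) = Real.logb b τ)) ∧
      (∀ k : ℕ, 1 ≤ k → (τ ≤ Pnz k ↔ (k : ℝ) ≤ Real.logb b τ)) ∧
      IsGreatest {K : ℕ | ∀ k : ℕ, 1 ≤ k → k ≤ K → τ ≤ Pnz k} ⌊Real.logb b τ⌋₊) := by
  intro Ab1 Ae1 b Pnz
  have hA : 0 < Ab1 := SecrecyNet.A1_pos hd hυ hlamb hαb hμb hΩb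
  have hB : 0 < Ae1 * (ηb / ηe) ^ (-((d : ℝ) / υ)) :=
    mul_pos (SecrecyNet.A1_pos hd hυ hlame hαe hμe hΩe) (Real.rpow_pos_of_pos (div_pos hηb hηe) _)
  have hb0 : 0 < b := div_pos hA (add_pos hA hB)
  have hb1 : b < 1 := (div_lt_one (add_pos hA hB)).2 (lt_add_of_pos_right _ hB)
  have hF : ∀ k : ℕ, 1 ≤ k → Pnz k = b ^ k := fun k hk =>
    SecrecyNet.probNonzeroBB_eq_pow hd hυ hlamb hαb hμb hΩb hlame hαe hμe hΩe hηb hηe hb he hind hk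
  refine ⟨fun τ h0 h1 => ?_, fun τ h0 h1 => SecrecyNet.pow_logb_threshold hb0 hb1 hF h0 h1⟩
  -- The outage form is the reliability form at level `1 - τ`.
  have heq : ∀ k, 1 - Pnz k = τ ↔ Pnz k = 1 - τ := fun k => by
    constructor <;> intro h <;> linarith
  have hle : ∀ k, 1 - Pnz k ≤ τ ↔ 1 - τ ≤ Pnz k := fun k => sub_le_comm
  simp only [heq, hle]
  exact SecrecyNet.pow_logb_threshold hb0 hb1 hF (sub_pos.2 h1) (sub_le_self _ h0)
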